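/- **Setting.** Let $\mathcal C$ be a category whose hom-classes $\mathrm{Arr}(X,Y)$ are sets. Write $X\prec Y$ if there is an arrow from $X$ to $Y$. Direct systems are indexed by non-empty directed sets, and direct limits are taken in $\mathcal C$. A class $\mathcal F$ of objects is called *proper* if there is a set of objects containing an isomorphic copy of every member of $\mathcal F$. Assume that every object $X$ is assigned a cardinal number $|X|$ (its *size*), and write $\mathrm{FIN}(X)$ for the class of all objects $A$ of finite size with $A\prec X$. Assume moreover: - (Arr) all arrows of $\mathcal C$ are monomorphisms; - (Sys) all direct systems in $\mathcal C$ have direct limits; - (Card) isomorphic objects have the same size; - (Lim) each object of infinite size $\alpha$ is isomorphic to the direct limit of a direct system of at most $\alpha$ objects of finite size; - (Size) the direct limit of a direct system of $\alpha\ge\aleph_0$ objects of finite size has size at most $\alpha$; - (Dir) if $X,Y$ have finite size and $u\colon X\to Z$, $v\colon Y\to Z$ are arrows, then there are an object $W$ of finite size and arrows $a\colon X\to W$, $b\colon Y\to W$, $c\colon W\to Z$ with $u=c\circ a$ and $v=c\circ b$; - (Fin) for each object $X$ the class $\mathrm{FIN}(X)$ is proper; - (Upp) for each object $X$ there is a cardinal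 $\mathfrak m$ such that $|Y|\le\mathfrak m$ whenever $Y\prec X$; - (Emb) if $X$ has finite size and $X\prec W$, where $W$ is the direct limit of a direct system $(Z_\alpha)$, then $X\prec Z_\alpha$ for some $\alpha$. **Definitions.** An object $X$ is *absolutely homogeneous* (AB-HO) if for every object $A$ and all arrows $u,v\colon A\to X$ there is an automorphism $\varphi$ of $X$ with $v=\varphi\circ u$. A *finitary structure* is a class $\mathcal F$ of objects of finite size that is closed under isomorphic copies and such that $X\in\mathcal F$ whenever $X\prec Y\in\mathcal F$ and $X$ has finite size. An object $X$ is *finitely represented* in $\mathcal F$ if $\mathrm{FIN}(X)\subset\mathcal F$; the class of all such objects is denoted by $\langle\mathcal F\rangle$. A class $\mathcal E$ of objects has the *amalgamation property* (AP) if - for all $X,Y,Z\in\mathcal E$ and arrows $u\colon X\to Y$, $v\colon X\to Z$ there are $W\in\mathcal E$ and arrows $p\colon Y\to W$, $q\colon Z\to W$ with $p\circ u=q\circ v$; and - for all $X,Y\in\mathcal E$ there is $Z\in\mathcal E$ with $X\prec Z$ and $Y\prec Z$. A finitary structure $\mathcal F$ has AP* if $\langle\mathcal F\rangle$ has AP.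 It satisfies the *size boundedness principle* if there is a cardinal $\mathfrak m$ with $|X|\le\mathfrak m$ for all $X\in\langle\mathcal F\rangle$. A *skeletoid* is a proper finitary structure that satisfies the size boundedness principle and has AP. A *skeleton* is a class of the form $\mathrm{FIN}(X)$ for some AB-HO object $X$. **Theorem.** 1. A class of objects of $\mathcal C$ is a skeleton if and only if it is a non-empty skeletoid with AP*. 2. Let $X$ be an AB-HO object of $\mathcal C$ and $\mathcal F=\mathrm{FIN}(X)$. Then: - (A) for every object $Y$, $Y\prec X$ if and only if $Y\in\langle\mathcal F\rangle$; - (B) $\mathcal F$ is a proper finitary structure with AP; - (C) the class $\langle\mathcal F\rangle$ is proper and has AP. -/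

import Mathlib

universe v u

open CategoryTheory CategoryTheory.Limits Cardinal

/-! A *set* of the metatheory is a type in `Type v` (up to bijection, a `v`-small type), a *class of
objects* of `C` is an `ObjectProperty C`, and a cardinal number is an element of `Cardinal.{v}`.
Since the category is a `Category.{v}`, the arrows between two objects always form a set.
A direct system is a functor from a non-empty directed preorder (a set), and its direct limit is its
colimit in `C`. -/

namespace AbsHom

section Basic

variable {C : Type u} [Category.{v} C]

/-- `X` embeds into `Y`: there is an arrow from `X` to `Y`. -/
def Embeds (X Y : C) : Prop := Nonempty (X ⟶ Y)

/-- `X` is absolutely homogeneous: any two arrows from the same object into `X` differ by an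
automorphism of `X`. -/
def IsABHO (X : C) : Prop :=
  ∀ (A : C) (f g : A ⟶ X), ∃ φ : Aut X, g = f ≫ φ.hom

/-- A class of objects is proper if some *set* of objects contains an isomorphic copy of each
of its members. -/
def IsProperClass (F : ObjectProperty C) : Prop :=
  ObjectProperty.EssentiallySmall.{v} F

/-- The amalgamation property of a class of objects (including joint embedding). -/
structure HasAP (F : ObjectProperty C) : Prop where
  amalgamation : ∀ (X Y Z : C), F X → F Y → F Z → ∀ (f : X ⟶ Y) (g : X ⟶ Z),
    ∃ (W : C) (p : Y ⟶ W) (q : Z ⟶ W), F W ∧ f ≫ p = g ≫ q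
  joint_embedding : ∀ (X Y : C), F X → F Y → ∃ Z : C, F Z ∧ Embeds X Z ∧ Embeds Y Z

end Basic

section Size

variable {C : Type u} [Category.{v} C] (size : C → Cardinal.{v})

/-- The object `X` has finite size. -/
def FiniteSize (X : C) : Prop := size X < ℵ₀

/-- The class of all objects of finite size that embed into `X`
(the finitary structure induced by `X`). -/
def FinStr (X : C) : ObjectProperty C := fun A => FiniteSize size A ∧ Embeds A X

/-- The axioms on a category and on an assignment `size` of cardinal numbers to its objects. -/
structure IsSizedCategory : Prop where
  /-- (Arr): all arrows are monomorphisms. -/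
  arr : ∀ {X Y : C} (f : X ⟶ Y), Mono f
  /-- (Sys): all direct systems have direct limits. -/
  sys : ∀ (J : Type v) [Preorder J] [IsDirectedOrder J] [Nonempty J] (Z : J ⥤ C), HasColimit Z
  /-- (Card): isomorphic objects have the same size. -/
  card : ∀ {X Y : C}, Nonempty (X ≅ Y) → size X = size Y
  /-- (Lim): an object of infinite size `α` is the direct limit of at most `α` objects of
  finite size. -/
  lim : ∀ X : C, ℵ₀ ≤ size X →
    ∃ (J : Type v) (_ : Preorder J) (_ : IsDirectedOrder J) (_ : Nonempty J) (Z : J ⥤ C)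
      (c : Cocone Z) (_ : IsColimit c),
      #J ≤ size X ∧ (∀ j, FiniteSize size (Z.obj j)) ∧ Nonempty (X ≅ c.pt)
  /-- (Size): the direct limit of `α ≥ ℵ₀` objects of finite size has size at most `α`. -/
  size_le : ∀ (J : Type v) [Preorder J] [IsDirectedOrder J] [Nonempty J] (Z : J ⥤ C)
    (c : Cocone Z), IsColimit c → ℵ₀ ≤ #J → (∀ j, FiniteSize size (Z.obj j)) → size c.pt ≤ #J
  /-- (Dir): two arrows into `Z` from objects of finite size factor through a common arrow
  from an object of finite size. -/
  dir : ∀ (X Y Z : C), FiniteSize size X → FiniteSize size Y → ∀ (f : X ⟶ Z) (g : Y ⟶ Z),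
    ∃ (W : C) (a : X ⟶ W) (b : Y ⟶ W) (c : W ⟶ Z), FiniteSize size W ∧ f = a ≫ c ∧ g = b ≫ c
  /-- (Fin): the class of objects of finite size that embed into a given object is proper. -/
  fin : ∀ X : C, IsProperClass (FinStr size X)
  /-- (Upp): the sizes of objects that embed into a given object are bounded. -/
  upp : ∀ X : C, ∃ m : Cardinal.{v}, ∀ Y : C, Embeds Y X → size Y ≤ m
  /-- (Emb): an object of finite size that embeds into a direct limit embeds into some object of
  the direct system. -/
  emb : ∀ X : C, FiniteSize size X →
    ∀ (J : Type v) [Preorder J] [IsDirectedOrder J] [Nonempty J] (Z : J ⥤ C)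
      (c : Cocone Z), IsColimit c → Embeds X c.pt → ∃ j, Embeds X (Z.obj j)

/-- A finitary structure: a class of objects of finite size that is closed under isomorphic copies
and hereditary with respect to finite size. -/
structure IsFinitaryStructure (F : ObjectProperty C) : Prop where
  finite_size : ∀ X : C, F X → FiniteSize size X
  iso : ∀ X Y : C, Nonempty (X ≅ Y) → F Y → F X
  hereditary : ∀ X Y : C, Embeds X Y → F Y → FiniteSize size X → F X

/-- The class of all objects that are finitely represented in `F`. -/
def Gen (F : ObjectProperty C) : ObjectProperty C :=
  fun X => ∀ A : C, FiniteSize size A → Embeds A X → F A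

/-- AP*: the class of objects that are finitely represented in `F` has the amalgamation
property. -/
def HasAPStar (F : ObjectProperty C) : Prop := HasAP (Gen size F)

/-- The size boundedness principle. -/
def HasSBP (F : ObjectProperty C) : Prop :=
  ∃ m : Cardinal.{v}, ∀ X : C, Gen size F X → size X ≤ m

/-- A skeletoid: a proper finitary structure with the size boundedness principle and the
amalgamation property. -/
structure IsSkeletoid (F : ObjectProperty C) : Prop where
  finitary : IsFinitaryStructure size F
  proper : IsProperClass F
  sbp : HasSBP size F
  ap : HasAP F

/-- A skeleton: the finitary structure induced by some absolutely homogeneous object. -/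
def IsSkeleton (F : ObjectProperty C) : Prop := ∃ X : C, IsABHO X ∧ F = FinStr size X

end Size

end AbsHom

namespace AbsHom

/-- Arrows with the same target that are equal in the arrow category factor through each other. -/
theorem exists_comp_eq_of_arrow_mk_eq {D : Type*} [Category* D] {A B W : D} {f : A ⟶ W} {g : B ⟶ W}
    (h : Arrow.mk f = Arrow.mk g) : ∃ θ : A ⟶ B, θ ≫ g = f := by
  obtain rfl : A = B := congrArg (fun a : Arrow D => a.left) h
  obtain rfl := Arrow.mk_injective _ _ h
  exact ⟨𝟙 _, Category.id_comp _⟩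

theorem isIso_of_mono_of_comp_eq_id {D : Type*} [Category* D] {A B : D} {f : A ⟶ B} {g : B ⟶ A}
    [Mono f] (h : g ≫ f = 𝟙 B) : IsIso f :=
  ⟨g, by rw [← cancel_mono f, Category.assoc, h, Category.comp_id, Category.id_comp], h⟩

/-- In an essentially small category with directed colimits all of whose arrows are monomorphisms,
every object has an arrow to an object from which all arrows are isomorphisms. -/
theorem exists_maximal {D : Type*} [Category* D] [EssentiallySmall.{v} D]
    (hmono : ∀ {A B : D} (f : A ⟶ B), Mono f)
    (hcolim : ∀ (J : Type v) [Preorder J] [IsDirectedOrder J] [Nonempty J],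
      HasColimitsOfShape J D) (X : D) :
    ∃ (M : D) (_ : X ⟶ M), ∀ (Y : D) (f : M ⟶ Y), IsIso f := by
  by_contra! hcon
  have hstep (M : D) : ∃ (Y : D) (f : M ⟶ Y), Nonempty (X ⟶ M) → ¬ IsIso f := by
    by_cases hM : Nonempty (X ⟶ M)
    · obtain ⟨Y, f, hf⟩ := hcon M hM.some
      exact ⟨Y, f, fun _ => hf⟩
    · exact ⟨M, 𝟙 M, fun h => absurd h hM⟩
  choose next toNext hnext using hstep
  let Φ : SmallObject.SuccStruct D := { X₀ := X, succ := next, toSucc := toNext }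
  let e := equivSmallModel.{v} D
  let c : Cardinal.{v} := max ℵ₀ (Order.succ #(Arrow (SmallModel.{v} D)))
  let J := c.ord.ToType
  have hc : ℵ₀ ≤ c := le_max_left _ _
  have : NoMaxOrder J := Cardinal.noMaxOrder hc
  have : Nonempty J := by
    rw [← Cardinal.mk_ne_zero_iff, Cardinal.mk_ord_toType]
    exact (Cardinal.aleph0_pos.trans_le hc).ne'
  let _ : OrderBot J := WellFoundedLT.toOrderBot J
  let _ : SuccOrder J := SuccOrder.ofLinearWellFoundedLT J
  have : HasIterationOfShape J D :=
    { hasColimitsOfShape_of_isSuccLimit := fun j hj => by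
        have : Nonempty (Set.Iio j) := ⟨⟨⊥, hj.bot_lt⟩⟩
        exact hcolim _
      hasColimitsOfShape := hcolim _ }
  let G := Φ.iterationFunctor J
  let ι := (Φ.iterationCocone J).ι
  have hinj : Function.Injective
      (fun j : J => Arrow.mk (e.functor.map (ι.app j))) := by
    refine Function.Injective.of_lt_imp_ne fun j k hjk h => ?_
    obtain ⟨θ', hθ'⟩ := exists_comp_eq_of_arrow_mk_eq h.symm
    obtain ⟨θ, rfl⟩ := e.functor.map_surjective θ'
    rw [← e.functor.map_comp] at hθ'
    have hθ : θ ≫ ι.app j = ι.app k := e.functor.map_injective hθ'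
    have hle : Order.succ j ≤ k := Order.succ_le_of_lt hjk
    have hfac : (θ ≫ G.map (homOfLE (Order.le_succ j))) ≫ G.map (homOfLE hle) = 𝟙 _ := by
      have := hmono (ι.app k)
      rw [← cancel_mono (ι.app k), Category.assoc, Category.assoc, Category.id_comp]
      erw [(Φ.iterationCocone J).w, (Φ.iterationCocone J).w]
      exact hθ
    have := hmono (G.map (homOfLE hle))
    have h1 : IsIso (G.map (homOfLE hle)) := isIso_of_mono_of_comp_eq_id hfac
    have := hmono (G.map (homOfLE (Order.le_succ j)))
    have h2 : IsIso (G.map (homOfLE (Order.le_succ j))) := by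
      refine isIso_of_mono_of_comp_eq_id (g := G.map (homOfLE hle) ≫ θ) ?_
      rw [← cancel_mono (G.map (homOfLE hle)), Category.assoc, Category.assoc,
        ← Category.assoc θ, hfac, Category.comp_id, Category.id_comp]
    have h3 := Φ.iterationFunctor_map_succ j (not_isMax j)
    refine hnext (G.obj j) ⟨(Φ.ιIterationFunctor J).app j⟩ ?_
    have h4 : Φ.toSucc (G.obj j) = G.map (homOfLE (Order.le_succ j)) ≫
        (Φ.iterationFunctorObjSuccIso j (not_isMax j)).hom := by
      simp [G, h3]
    change IsIso (Φ.toSucc (G.obj j))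
    rw [h4]
    infer_instance
  have hle := Cardinal.mk_le_of_injective hinj
  rw [Cardinal.mk_ord_toType] at hle
  exact absurd ((le_max_right _ _).trans hle) (not_le.2 (Order.lt_succ _))

section PartialCocone

variable {C : Type u} [Category.{v} C] {J : Type v} [Preorder J]

/-- Compatible families of arrows to `X` from the objects of the diagram `Z` with index in `S`. -/
@[ext]
structure PartialCocone (Z : J ⥤ C) (X : C) (S : Set J) : Type v where
  /-- The arrows of the family. -/
  app (j : J) (hj : j ∈ S) : Z.obj j ⟶ X
  w (j k : J) (hj : j ∈ S) (hk : k ∈ S) (h : j ≤ k) : Z.map (homOfLE h) ≫ app k hk = app j hj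

namespace PartialCocone

variable {Z : J ⥤ C} {X : C} {S T : Set J}

/-- The restriction of a partial cocone to a smaller set of indices. -/
def restrict (h : S ⊆ T) (t : PartialCocone Z X T) : PartialCocone Z X S :=
  ⟨fun j hj => t.app j (h hj), fun j k hj hk => t.w j k (h hj) (h hk)⟩

/-- Postcomposition of a partial cocone with an arrow. -/
def postcomp {Y : C} (t : PartialCocone Z X S) (φ : X ⟶ Y) : PartialCocone Z Y S :=
  ⟨fun j hj => t.app j hj ≫ φ, fun j k hj hk h => by rw [← Category.assoc, t.w j k hj hk h]⟩

/-- A partial cocone factors through the colimit of the restricted diagram. -/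
theorem exists_desc (t : PartialCocone Z X S)
    [HasColimit ((Subtype.mono_coe (· ∈ S)).functor ⋙ Z)] :
    ∃ d : colimit ((Subtype.mono_coe (· ∈ S)).functor ⋙ Z) ⟶ X,
      ∀ j (hj : j ∈ S),
        colimit.ι ((Subtype.mono_coe (· ∈ S)).functor ⋙ Z) ⟨j, hj⟩ ≫ d = t.app j hj := by
  let c : Cocone ((Subtype.mono_coe (· ∈ S)).functor ⋙ Z) :=
    { pt := X
      ι := { app := fun j => t.app j.1 j.2
             naturality := fun j k g =>
              (t.w j.1 k.1 j.2 k.2 g.le).trans (Category.comp_id _).symm } }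
  exact ⟨colimit.desc _ c, fun j hj => colimit.ι_desc c ⟨j, hj⟩⟩

/-- Partial cocones to an absolutely homogeneous object extend to a larger set of indices, provided
that there is some partial cocone on that set. -/
theorem exists_restrict_eq (hX : IsABHO X) (h : S ⊆ T)
    [HasColimit ((Subtype.mono_coe (· ∈ S)).functor ⋙ Z)]
    (t : PartialCocone Z X T) (s : PartialCocone Z X S) :
    ∃ t' : PartialCocone Z X T, t'.restrict h = s := by
  obtain ⟨d, hd⟩ := (t.restrict h).exists_desc
  obtain ⟨d', hd'⟩ := s.exists_desc
  obtain ⟨φ, hφ⟩ := hX _ d d'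
  refine ⟨t.postcomp φ.hom, PartialCocone.ext (funext fun j => funext fun hj => ?_)⟩
  rw [← hd' j hj, hφ, ← Category.assoc, hd j hj]
  rfl

/-- The full cocone condition can be checked on a cofinal reindexing. -/
theorem nonempty_of_reindex {K : Type v} [Preorder K] [IsDirectedOrder K] {u : K → J}
    (hu : Monotone u) (hcof : ∀ j, ∃ k, j ≤ u k)
    (t : PartialCocone (hu.functor ⋙ Z) X Set.univ) : Nonempty (PartialCocone Z X Set.univ) := by
  obtain ⟨f, hf⟩ : ∃ f : ∀ k, Z.obj (u k) ⟶ X,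
      ∀ k l (h : k ≤ l), Z.map (homOfLE (hu h)) ≫ f l = f k :=
    ⟨fun k => t.app k trivial, fun k l h => t.w k l trivial trivial h⟩
  choose r hr using hcof
  have key : ∀ (j : J) (k k' : K) (h : j ≤ u k) (h' : j ≤ u k'),
      Z.map (homOfLE h) ≫ f k = Z.map (homOfLE h') ≫ f k' := by
    intro j k k' h h'
    obtain ⟨m, hm, hm'⟩ := exists_ge_ge k k'
    rw [← hf k m hm, ← hf k' m hm', ← Category.assoc, ← Category.assoc, ← Functor.map_comp,
      ← Functor.map_comp]
    rfl
  refine ⟨fun j _ => Z.map (homOfLE (hr j)) ≫ f (r j), fun j k _ _ h => ?_⟩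
  rw [← Category.assoc, ← Functor.map_comp]
  exact key _ _ _ (h.trans (hr k)) _

end PartialCocone

open Opposite in
/-- The presheaf of partial cocones along a monotone family of sets of indices. -/
def partialCoconeFunctor (Z : J ⥤ C) (X : C) {I : Type v} [Preorder I] (S : I → Set J)
    (hS : Monotone S) : Iᵒᵖ ⥤ Type v where
  obj i := PartialCocone Z X (S i.unop)
  map g := ↾(PartialCocone.restrict (hS g.unop.le))

open Opposite in
/-- A cocone to an absolutely homogeneous object can be constructed along a continuous well-ordered
exhaustion of the diagram by directed sets. -/
theorem PartialCocone.nonempty_of_exhaustion {Z : J ⥤ C} {X : C} (hX : IsABHO X)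
    {I : Type v} [LinearOrder I] [WellFoundedLT I] [Nonempty I] {S : I → Set J}
    (hS : Monotone S) (hcolim : ∀ i, HasColimit ((Subtype.mono_coe (· ∈ S i)).functor ⋙ Z))
    (hlim : ∀ i, Order.IsSuccLimit i → ∀ j ∈ S i, ∃ k < i, j ∈ S k)
    (hunion : ∀ j, ∃ i, j ∈ S i) (hne : ∀ i, Nonempty (PartialCocone Z X (S i))) :
    Nonempty (PartialCocone Z X Set.univ) := by
  let _ : OrderBot I := WellFoundedLT.toOrderBot I
  let _ : SuccOrder I := SuccOrder.ofLinearWellFoundedLT I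
  have glue (P : I → Prop) (x : ∀ i, P i → PartialCocone Z X (S i))
      (hx : ∀ i k (hi : P i) (hk : P k) (h : i ≤ k), (x k hk).restrict (hS h) = x i hi)
      (T : Set J) (hT : ∀ j ∈ T, ∃ i, P i ∧ j ∈ S i) :
      ∃ y : PartialCocone Z X T, ∀ i (hi : P i) j (hj : j ∈ T) (hj' : j ∈ S i),
        y.app j hj = (x i hi).app j hj' := by
    choose! r hrP hrS using hT
    have hval : ∀ i k (hi : P i) (hk : P k) j (hj : j ∈ S i) (hj' : j ∈ S k),
        (x i hi).app j hj = (x k hk).app j hj' := by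
      intro i k hi hk j hj hj'
      obtain h | h := le_total i k
      · rw [← hx i k hi hk h]; rfl
      · rw [← hx k i hk hi h]; rfl
    refine ⟨⟨fun j hj => (x (r j) (hrP j hj)).app j (hrS j hj), fun j k hj hk h => ?_⟩,
      fun i hi j hj hj' => hval _ _ _ _ _ _ _⟩
    have hm : P (max (r j) (r k)) := by
      obtain h | h := max_choice (r j) (r k) <;> rw [h]
      exacts [hrP j hj, hrP k hk]
    rw [hval _ _ (hrP j hj) hm j _ (hS (le_max_left _ _) (hrS j hj)),
      hval _ _ (hrP k hk) hm k _ (hS (le_max_right _ _) (hrS k hk))]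
    exact (x _ hm).w _ _ _ _ h
  let F := partialCoconeFunctor Z X S hS
  have d : F.WellOrderInductionData := by
    refine Functor.WellOrderInductionData.ofExists (fun i _ s => ?_) (fun i hi x => ?_)
    · exact PartialCocone.exists_restrict_eq hX (hS (Order.le_succ i)) (hne _).some s
    · obtain ⟨y, hy⟩ := glue (· < i) (fun k hk => x.1 (op ⟨k, hk⟩))
        (fun k l hk hl h => x.2 (homOfLE (show (⟨k, hk⟩ : Set.Iio i) ≤ ⟨l, hl⟩ from h)).op)
        (S i) (hlim i hi)
      exact ⟨y, fun k hk => PartialCocone.ext (funext fun j => funext fun hj => hy k hk j _ hj)⟩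
  have x := d.sectionsMk (hne ⊥).some
  obtain ⟨y, -⟩ := glue (fun _ => True) (fun i _ => x.1 (op i))
    (fun k l _ _ h => x.2 (homOfLE h).op) Set.univ (fun j _ => by simpa using hunion j)
  exact ⟨y⟩

/-- A diagram indexed by the finite subsets of a set has a cocone to an absolutely homogeneous
object as soon as all its objects embed into that object. -/
theorem IsABHO.nonempty_partialCocone_finset {X : C} (hX : IsABHO X)
    (hsys : ∀ (J : Type v) [Preorder J] [IsDirectedOrder J] [Nonempty J] (Z : J ⥤ C), HasColimit Z)
    (I : Type v) (Z : Finset I ⥤ C) (hZ : ∀ s, Embeds (Z.obj s) X) :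
    Nonempty (PartialCocone Z X Set.univ) := by
  induction hκ : #I using WellFoundedLT.induction generalizing I with
  | ind κ ih =>
    subst hκ
    obtain hfin | hinf := finite_or_infinite I
    · have := Fintype.ofFinite I
      obtain ⟨f⟩ := hZ Finset.univ
      refine ⟨fun s _ => Z.map (homOfLE s.subset_univ) ≫ f, fun s t _ _ h => ?_⟩
      rw [← Category.assoc, ← Functor.map_comp]
      rfl
    · let K := (#I).ord.ToType
      have : NoMaxOrder K := Cardinal.noMaxOrder (Cardinal.aleph0_le_mk I)
      have : Nonempty K := by
        rw [← Cardinal.mk_ne_zero_iff, Cardinal.mk_ord_toType]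
        exact Cardinal.mk_ne_zero I
      obtain ⟨e⟩ : Nonempty (K ≃ I) := Cardinal.eq.1 (Cardinal.mk_ord_toType _)
      classical
      have hu : Monotone (fun s : Finset K => s.map e.toEmbedding) :=
        fun s t h => Finset.map_subset_map.2 h
      suffices h : ∀ Z : Finset K ⥤ C, (∀ s, Embeds (Z.obj s) X) →
          Nonempty (PartialCocone Z X Set.univ) from
        PartialCocone.nonempty_of_reindex hu (fun s => ⟨s.map e.symm.toEmbedding, by
          simp [Finset.map_map]⟩) (h (hu.functor ⋙ Z) fun s => hZ _).some
      clear hZ Z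
      intro Z hZ
      have hdir (i : K) : IsDirectedOrder {s : Finset K | ∀ x ∈ s, x < i} :=
        ⟨fun s t => ⟨⟨s.1 ∪ t.1, fun x hx => (Finset.mem_union.1 hx).elim (s.2 x) (t.2 x)⟩,
          Finset.subset_union_left, Finset.subset_union_right⟩⟩
      have hnonempty (i : K) : Nonempty {s : Finset K | ∀ x ∈ s, x < i} := ⟨⟨∅, by simp⟩⟩
      refine PartialCocone.nonempty_of_exhaustion hX (S := fun i => {s | ∀ x ∈ s, x < i})
        (fun i k h s hs x hx => (hs x hx).trans_le h) (fun i => hsys _ _) ?_ ?_ ?_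
      · intro i hi s hs
        obtain rfl | hne := s.eq_empty_or_nonempty
        · obtain ⟨k, hk⟩ := not_isMin_iff.1 hi.not_isMin
          exact ⟨k, hk, by simp⟩
        · obtain ⟨k, hk, hki⟩ := hi.lt_iff_exists_lt.1 (hs _ (s.max'_mem hne))
          exact ⟨k, hk, fun x hx => (s.le_max' x hx).trans_lt hki⟩
      · intro s
        obtain rfl | hne := s.eq_empty_or_nonempty
        · exact ⟨Classical.arbitrary K, by simp⟩
        · obtain ⟨k, hk⟩ := exists_gt (s.max' hne)
          exact ⟨k, fun x hx => (s.le_max' x hx).trans_lt hk⟩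
      · intro i
        have hi : #(Set.Iio i) < #I := by
          have := Cardinal.mk_Iio_lt i (by simp [K])
          simpa [K] using this
        have hv : Monotone (fun s : Finset (Set.Iio i) => s.map (Function.Embedding.subtype _)) :=
          fun s t h => Finset.map_subset_map.2 h
        obtain ⟨t⟩ := ih _ hi _ (hv.functor ⋙ Z) (fun s => hZ _) rfl
        obtain ⟨f, hf⟩ : ∃ f : ∀ s : Finset (Set.Iio i),
            Z.obj (s.map (Function.Embedding.subtype _)) ⟶ X,
            ∀ s s' (h : s ≤ s'), Z.map (homOfLE (hv h)) ≫ f s' = f s :=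
          ⟨fun s => t.app s trivial, fun s s' h => t.w s s' trivial trivial h⟩
        have hle (s : Finset K) (hs : ∀ x ∈ s, x < i) :
            s ≤ (s.subtype (· ∈ Set.Iio i)).map (Function.Embedding.subtype _) :=
          (Finset.subtype_map_of_mem (p := (· ∈ Set.Iio i)) hs).ge
        refine ⟨fun s hs => Z.map (homOfLE (hle s hs)) ≫ f (s.subtype (· ∈ Set.Iio i)),
          fun s s' hs hs' h => ?_⟩
        rw [← hf _ (s'.subtype (· ∈ Set.Iio i)) (Finset.subtype_mono h), ← Category.assoc,
          ← Category.assoc, ← Functor.map_comp, ← Functor.map_comp]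
        rfl

/-- In a directed preorder, upper bounds of finite sets can be chosen monotonically. -/
theorem exists_monotone_finset_le (J : Type*) [Preorder J] [IsDirectedOrder J] [Nonempty J] :
    ∃ u : Finset J → J, Monotone u ∧ ∀ j, j ≤ u {j} := by
  classical
  have hb (s : Finset J) : ∃ m, ∀ j ∈ s, j ≤ m := s.exists_le
  choose b hb using hb
  let u : Finset J → J := Finset.strongInduction fun s r =>
    b (s ∪ s.ssubsets.attach.image fun t => r t.1 (Finset.mem_ssubsets.1 t.2))
  have hu (s : Finset J) : u s = b (s ∪ s.ssubsets.attach.image fun t => u t.1) :=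
    Finset.strongInduction_eq _ s
  refine ⟨u, fun s t h => ?_, fun j => ?_⟩
  · obtain rfl | h := h.eq_or_ssubset
    · rfl
    · rw [hu t]
      refine hb _ _ (Finset.mem_union_right _ (Finset.mem_image.2
        ⟨⟨s, Finset.mem_ssubsets.2 h⟩, Finset.mem_attach _ _, rfl⟩))
  · rw [hu]
    exact hb _ _ (Finset.mem_union_left _ (Finset.mem_singleton_self j))

/-- If all objects of a direct system embed into an absolutely homogeneous object, then so does
its direct limit. -/
theorem IsABHO.embeds_of_isColimit {X : C} (hX : IsABHO X)
    (hsys : ∀ (J : Type v) [Preorder J] [IsDirectedOrder J] [Nonempty J] (Z : J ⥤ C), HasColimit Z)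
    [IsDirectedOrder J] [Nonempty J] {Z : J ⥤ C} (hZ : ∀ j, Embeds (Z.obj j) X)
    {c : Cocone Z} (hc : IsColimit c) : Embeds c.pt X := by
  classical
  obtain ⟨u, hu, hcof⟩ := exists_monotone_finset_le J
  obtain ⟨t⟩ := hX.nonempty_partialCocone_finset hsys J (hu.functor ⋙ Z) (fun s => hZ _)
  obtain ⟨s⟩ := PartialCocone.nonempty_of_reindex hu (fun j => ⟨{j}, hcof j⟩) t
  exact ⟨hc.desc ⟨X, { app := fun j => s.app j trivial
                       naturality := fun j k g =>
                        (s.w j k trivial trivial g.le).trans (Category.comp_id _).symm }⟩⟩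

end PartialCocone

section Size

variable {C : Type u} [Category.{v} C] {size : C → Cardinal.{v}}

theorem Embeds.trans {X Y Z : C} : Embeds X Y → Embeds Y Z → Embeds X Z :=
  fun ⟨f⟩ ⟨g⟩ => ⟨f ≫ g⟩

theorem Gen.of_embeds {F : ObjectProperty C} {X Y : C} (hY : Gen size F Y) (h : Embeds X Y) :
    Gen size F X :=
  fun A hA hAX => hY A hA (hAX.trans h)

theorem IsFinitaryStructure.le_gen {F : ObjectProperty C} (hF : IsFinitaryStructure size F) :
    F ≤ Gen size F :=
  fun X hX A hA hAX => hF.hereditary A X hAX hX hA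

namespace IsSizedCategory

variable (hC : IsSizedCategory size)
include hC

theorem isFinitaryStructure_finStr (X : C) : IsFinitaryStructure size (FinStr size X) where
  finite_size _ hA := hA.1
  iso _ _ := fun ⟨e⟩ hB => ⟨(hC.card ⟨e⟩).trans_lt hB.1, Embeds.trans ⟨e.hom⟩ hB.2⟩
  hereditary _ _ hAB hB hA := ⟨hA, hAB.trans hB.2⟩

theorem exists_finStr (X : C) : ∃ A, FinStr size X A := by
  obtain hX | hX := lt_or_ge (size X) ℵ₀
  · exact ⟨X, hX, ⟨𝟙 X⟩⟩
  · obtain ⟨J, _, _, hJ, Z, c, -, -, hZ, ⟨e⟩⟩ := hC.lim X hX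
    exact ⟨Z.obj hJ.some, hZ _, ⟨c.ι.app _ ≫ e.inv⟩⟩

theorem gen_isClosedUnderColimitsOfShape (F : ObjectProperty C) (J : Type v) [Preorder J]
    [IsDirectedOrder J] [Nonempty J] : (Gen size F).IsClosedUnderColimitsOfShape J where
  colimitsOfShape_le X := fun ⟨p⟩ A hA hAX => by
    obtain ⟨j, hj⟩ := hC.emb A hA J p.diag p.cocone p.isColimit hAX
    exact p.prop_diag_obj j A hA hj

/-- The class of objects that are finitely represented in a proper class is proper, if their sizes
are bounded. -/
theorem isProperClass_gen {F : ObjectProperty C} (hF : IsProperClass F) (hsbp : HasSBP size F) :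
    IsProperClass (Gen size F) := by
  obtain ⟨m, hm⟩ := hsbp
  let κ : Cardinal.{v} := Order.succ (max m ℵ₀)
  have hκ : ℵ₀ ≤ κ := (le_max_right _ _).trans (Order.le_succ _)
  have : ObjectProperty.EssentiallySmall.{v} F := hF
  refine ObjectProperty.EssentiallySmall.of_le (Q := F.colimitsCardinalClosure κ) fun X hX => ?_
  obtain hfin | hinf := lt_or_ge (size X) ℵ₀
  · exact F.le_colimitsCardinalClosure κ _ (hX X hfin ⟨𝟙 X⟩)
  · obtain ⟨J, _, _, _, Z, c, hc, hJ, hZ, ⟨e⟩⟩ := hC.lim X hinf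
    have hJκ : HasCardinalLT J κ := (hasCardinalLT_iff_cardinal_mk_lt J κ).2
      (Order.lt_succ_of_le ((hJ.trans (hm X hX)).trans (le_max_left _ _)))
    have harr : HasCardinalLT (Arrow J) κ :=
      (hasCardinalLT_prod hκ hJκ hJκ).of_injective (fun a => (a.left, a.right)) fun a b h =>
        Arrow.ext (congrArg Prod.fst h) (congrArg Prod.snd h) (Subsingleton.elim _ _)
    have := F.isClosedUnderColimitsOfShape_colimitsCardinalClosure κ J harr
    refine (F.colimitsCardinalClosure κ).prop_of_iso e.symm
      ((F.colimitsCardinalClosure κ).prop_of_isColimit hc fun j => ?_)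
    exact F.le_colimitsCardinalClosure κ _ (hX _ (hZ j) ⟨c.ι.app j ≫ e.inv⟩)

/-- An object embeds into an absolutely homogeneous object `X` iff all its subobjects of finite
size do. -/
theorem embeds_iff_gen_finStr {X : C} (hX : IsABHO X) (Y : C) :
    Embeds Y X ↔ Gen size (FinStr size X) Y := by
  refine ⟨fun h A hA hAY => ⟨hA, hAY.trans h⟩, fun hY => ?_⟩
  obtain hfin | hinf := lt_or_ge (size Y) ℵ₀
  · exact (hY Y hfin ⟨𝟙 Y⟩).2
  · obtain ⟨J, _, _, _, Z, c, hc, -, hZ, ⟨e⟩⟩ := hC.lim Y hinf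
    exact Embeds.trans ⟨e.hom⟩ (hX.embeds_of_isColimit hC.sys
      (fun j => (hY _ (hZ j) ⟨c.ι.app j ≫ e.inv⟩).2) hc)

theorem hasSBP_finStr {X : C} (hX : IsABHO X) : HasSBP size (FinStr size X) := by
  obtain ⟨m, hm⟩ := hC.upp X
  exact ⟨m, fun Y hY => hm Y ((hC.embeds_iff_gen_finStr hX Y).2 hY)⟩

theorem hasAP_finStr {X : C} (hX : IsABHO X) : HasAP (FinStr size X) where
  amalgamation := by
    rintro A Y Z - ⟨hY, ⟨y⟩⟩ ⟨hZ, ⟨z⟩⟩ f g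
    obtain ⟨φ, hφ⟩ := hX A (f ≫ y) (g ≫ z)
    obtain ⟨W, p, q, c, hW, hp, hq⟩ := hC.dir Y Z X hY hZ (y ≫ φ.hom) z
    have := hC.arr c
    refine ⟨W, p, q, ⟨hW, ⟨c⟩⟩, ?_⟩
    rw [← cancel_mono c, Category.assoc, Category.assoc, ← hp, ← hq, hφ, Category.assoc]
  joint_embedding := by
    rintro Y Z ⟨hY, ⟨y⟩⟩ ⟨hZ, ⟨z⟩⟩
    obtain ⟨W, p, q, c, hW, -, -⟩ := hC.dir Y Z X hY hZ y z
    exact ⟨W, ⟨hW, ⟨c⟩⟩, ⟨p⟩, ⟨q⟩⟩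

theorem hasAPStar_finStr {X : C} (hX : IsABHO X) : HasAPStar size (FinStr size X) where
  amalgamation A Y Z _ hY hZ f g := by
    obtain ⟨y⟩ := (hC.embeds_iff_gen_finStr hX Y).2 hY
    obtain ⟨z⟩ := (hC.embeds_iff_gen_finStr hX Z).2 hZ
    obtain ⟨φ, hφ⟩ := hX A (f ≫ y) (g ≫ z)
    exact ⟨X, y ≫ φ.hom, z, (hC.embeds_iff_gen_finStr hX X).1 ⟨𝟙 X⟩, by
      rw [hφ, Category.assoc]⟩
  joint_embedding Y Z hY hZ :=
    ⟨X, (hC.embeds_iff_gen_finStr hX X).1 ⟨𝟙 X⟩, (hC.embeds_iff_gen_finStr hX Y).2 hY,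
      (hC.embeds_iff_gen_finStr hX Z).2 hZ⟩

/-- A non-empty proper finitary structure with the size boundedness principle and AP* is induced by
an absolutely homogeneous object. -/
theorem isSkeleton_of_hasAPStar {F : ObjectProperty C} (hF : IsFinitaryStructure size F)
    (hproper : IsProperClass F) (hsbp : HasSBP size F) (hap : HasAPStar size F)
    (hne : ∃ A, F A) : IsSkeleton size F := by
  obtain ⟨A, hA⟩ := hne
  have : ObjectProperty.EssentiallySmall.{v} (Gen size F) := hC.isProperClass_gen hproper hsbp
  obtain ⟨M, -, hM⟩ := exists_maximal.{v} (D := (Gen size F).FullSubcategory)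
    (fun f => (Gen size F).ι.mono_of_mono_map (hC.arr ((Gen size F).ι.map f)))
    (fun J _ _ _ => by
      have := hC.gen_isClosedUnderColimitsOfShape F J
      have : HasColimitsOfShape J C := ⟨fun Z => hC.sys J Z⟩
      infer_instance) ⟨A, hF.le_gen A hA⟩
  have hiso {Y : C} (hY : Gen size F Y) (f : M.obj ⟶ Y) : IsIso f := by
    have := hM ⟨Y, hY⟩ (ObjectProperty.homMk f)
    exact inferInstanceAs (IsIso ((Gen size F).ι.map (ObjectProperty.homMk f : M ⟶ ⟨Y, hY⟩)))
  refine ⟨M.obj, fun B f g => ?_, ?_⟩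
  · obtain ⟨W, p, q, hW, h⟩ := hap.amalgamation B _ _
      (M.property.of_embeds ⟨f⟩) M.property M.property f g
    have := hiso hW p
    have := hiso hW q
    refine ⟨asIso p ≪≫ (asIso q).symm, ?_⟩
    change g = f ≫ p ≫ inv q
    rw [← Category.assoc, h, Category.assoc, IsIso.hom_inv_id, Category.comp_id]
  · funext B
    refine propext ⟨fun hB => ⟨hF.finite_size B hB, ?_⟩, fun hB => M.property B hB.1 hB.2⟩
    obtain ⟨W, hW, hBW, ⟨f⟩⟩ := hap.joint_embedding B M.obj (hF.le_gen B hB) M.property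
    have := hiso hW f
    exact hBW.trans ⟨inv f⟩

end IsSizedCategory

end Size

end AbsHom

theorem mainTheorem13 {C : Type u} [Category.{v} C] (size : C → Cardinal.{v})
    (hC : AbsHom.IsSizedCategory size) :
    (∀ F : ObjectProperty C,
      AbsHom.IsSkeleton size F ↔
        (∃ A : C, F A) ∧ AbsHom.IsSkeletoid size F ∧ AbsHom.HasAPStar size F) ∧
    (∀ X : C, AbsHom.IsABHO X →
      (∀ Y : C, AbsHom.Embeds Y X ↔ AbsHom.Gen size (AbsHom.FinStr size X) Y) ∧
      (AbsHom.IsProperClass (AbsHom.FinStr size X) ∧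
        AbsHom.IsFinitaryStructure size (AbsHom.FinStr size X) ∧
        AbsHom.HasAP (AbsHom.FinStr size X)) ∧
      (AbsHom.IsProperClass (AbsHom.Gen size (AbsHom.FinStr size X)) ∧
        AbsHom.HasAP (AbsHom.Gen size (AbsHom.FinStr size X)))) := by
  refine ⟨fun F => ⟨?_, fun h => ?_⟩, fun X hX => ⟨hC.embeds_iff_gen_finStr hX,
    ⟨hC.fin X, hC.isFinitaryStructure_finStr X, hC.hasAP_finStr hX⟩,
    hC.isProperClass_gen (hC.fin X) (hC.hasSBP_finStr hX), hC.hasAPStar_finStr hX⟩⟩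
  · rintro ⟨X, hX, rfl⟩
    exact ⟨hC.exists_finStr X, ⟨hC.isFinitaryStructure_finStr X, hC.fin X, hC.hasSBP_finStr hX,
      hC.hasAP_finStr hX⟩, hC.hasAPStar_finStr hX⟩
  · exact hC.isSkeleton_of_hasAPStar h.2.1.finitary h.2.1.proper h.2.1.sbp h.2.2 h.1
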